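/- A transducer is a deterministic sequential transducer $T=(\{1,\dots,n\},1,\Delta)$ with $n\ge 1$ states, start state $1$ and transition function $\Delta:\{1,\dots,n\}\times\{0,1\}\to\{1,\dots,n\}\times\{0,1\}^*$; all its states are final, and two transducers are the same if they have the same transition function. It computes a function $T:\{0,1\}^*\to\{0,1\}^*$ by concatenating the outputs of the transitions used on the input. An encoding of transducers is a pair $S=(D_S,f_S)$, where $D_S\subseteq\{0,1\}^*$ and $f_S:D_S\to\{\text{all transducers}\}$, $\sigma\mapsto T^S_\sigma$, is a bijection. It is a polynomial-time encoding if $D_S\in\mathrm{P}$ and, given $\sigma\in D_S$, the list of transitions of $T^S_\sigma$ (with state names written in binary) can be computed in time polynomial in $|\sigma|$. For $x\in\{0,1\}^*$ let $$C_S(x)=\min\{|\sigma|+|p| : \sigma\in D_S,\ p\in\{0,1\}^*,\ T^S_\sigma(p)=x\},$$ and for $m\ge 0$ let $L^S_{\le m}$ be the set of all $x\in\{0,1\}^*$ for which there are $\sigma\in D_S$ and $p\in\{0,1\}^*$ such that $T^S_\sigma(p)=x$, $|\sigma|+|p|=C_S(x)$ and $T^S_\sigma$ has at most $m$ states (so $L^S_{\le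 0}=\emptyset$). There exists a polynomial-time encoding $S_1'$ such that $L^{S_1'}_{\le n-1}\subsetneq L^{S_1'}_{\le n}$ for every $n\ge 1$. -/

import Mathlib

namespace FSC

/-- A (left) sequential transducer with input and output alphabet `{0,1}` (a deterministic
generalised sequential machine, all states final). It is identified with its transition function;
the states are `1, …, numStates`, state `j` being the element `j - 1` of `Fin numStates`, and state
`1` is the start state. In particular there is at least one state. -/
structure Transducer where
  numStates : ℕ
  pos : 0 < numStates
  Δ : Fin numStates → Bool → Fin numStates × List Bool

namespace Transducer

/-- The start state, named `1`. -/
def start (T : Transducer) : Fin T.numStates := ⟨0, T.pos⟩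

/-- The output produced on an input word when starting in state `q`. -/
def runFrom (T : Transducer) : Fin T.numStates → List Bool → List Bool
  | _, [] => []
  | q, a :: x => (T.Δ q a).2 ++ runFrom T (T.Δ q a).1 x

/-- The function `{0,1}* → {0,1}*` computed by the transducer. -/
def run (T : Transducer) (p : List Bool) : List Bool := T.runFrom T.start p

/-- The name of a state, `bin(j)` for state `j ≥ 1`, most significant digit first, as a word over
`{0, 1, #}`. The letters `0, 1` are `some false, some true`, and `none` is the separator `#`. -/
def stateName {n : ℕ} (q : Fin n) : List (Option Bool) :=
  ((Nat.bits (q.val + 1)).reverse).map some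

/-- The transition `Δ(q, i) = (p, w)`, written `bin(q)#i#bin(p)#w#`. -/
def transition (T : Transducer) (q : Fin T.numStates) (i : Bool) : List (Option Bool) :=
  stateName q ++ [none, some i, none] ++ stateName (T.Δ q i).1 ++ [none] ++
    (T.Δ q i).2.map some ++ [none]

/-- The list of all transitions of the transducer, in the order
`(1,0), (1,1), (2,0), (2,1), …, (n,0), (n,1)`. -/
def transitionList (T : Transducer) : List (Option Bool) :=
  (List.finRange T.numStates).flatMap fun q => T.transition q false ++ T.transition q true

end Transducer

/-- A (bijective) encoding of all transducers by the words of a set `dom ⊆ {0,1}*`. -/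
structure Encoding where
  dom : Set (List Bool)
  decode : dom → Transducer
  bijective : Function.Bijective decode

namespace Encoding

open Classical in
/-- A polynomial-time (computable) encoding: the set of codes is decidable in polynomial time, and
some polynomial-time machine, given a code, outputs the list of transitions of the encoded
transducer, with state names in binary. Machines are Mathlib's multi-stack Turing machines. -/
structure IsPolyTime (S : Encoding) : Prop where
  mem_dom : Nonempty (Turing.TM2ComputableInPolyTime (fun w : List Bool => w)
    Computability.encodeBool (fun w : List Bool => decide (w ∈ S.dom)))
  decode : Nonempty (Turing.TM2ComputableInPolyTime (fun c : S.dom => (c : List Bool))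
    Transducer.transitionList S.decode)

/-- The finite-state complexity `C_S(x)`: the least size `|σ| + |p|` of a description of `x`.
The infimum is over a nonempty set, as the identity transducer has a code. -/
noncomputable def complexity (S : Encoding) (x : List Bool) : ℕ :=
  sInf {k | ∃ (c : S.dom) (p : List Bool), (S.decode c).run p = x ∧
    (c : List Bool).length + p.length = k}

/-- The language `L^S_{≤ m}` of all words with a minimal description by a transducer with at most
`m` states. -/
def level (S : Encoding) (m : ℕ) : Set (List Bool) :=
  {x | ∃ (c : S.dom) (p : List Bool), (S.decode c).run p = x ∧
    (c : List Bool).length + p.length = S.complexity x ∧ (S.decode c).numStates ≤ m}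

/-- The convention `L^S_{≤ 0} = ∅` is automatic, as every transducer has a state. -/
theorem level_zero (S : Encoding) : S.level 0 = ∅ := by
  refine Set.eq_empty_of_forall_notMem ?_
  rintro x ⟨c, p, -, -, h⟩
  exact absurd (S.decode c).pos (by omega)

end Encoding

end FSC

/-! Code a transducer by the list of its transitions. A transition of a transducer with `n`
states with target `t` and output `0ᵇ` or `z10ᵇ` is coded by the single word `0ᵃ` or `z10ᵃ`,
where `a = n * b + t` in the first case and `a = n * r b + t` in the second. Here `r` reflects
the interval `[0, n²]`, so that the output `x`, the letter `1` followed by `n²` zeros, is coded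
by a single letter if the target is the start state. This gives a short description of `x` with
`n` states. Transducers with more than `n` states have longer codes anyway. For a transducer with
`m < n` states whose transitions have codes of total length `e`, an input of length `k` yields at
most `e * k` letters, plus `m²` for each `1` in the output. To produce `x` it thus needs
`n² + 1 ≤ e * k + m²`, and then its description is longer by the inequality of arithmetic and
geometric means.

For every `n`, each word is the code of a transition, as the target is read modulo `n`. Therefore
the set of codes is regular, and the number of states can be read off from the number of separators.
The transitions are computed by a multi-stack machine, given by a structured program. -/

namespace FSC

open Turing StateTransition

section StackPrograms

variable {K : Type} {Γ : K → Type} {σ : Type}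

/-- Structured programs over a family of stacks with alphabets `Γ k` and a register of type `σ`,
the source language for the multi-stack machines `Turing.TM2`. The program `loop k f c p` pops the
stack `k` and updates the register by `f`; as long as the new register satisfies `c` it then runs
`p` and repeats. -/
inductive Prog (Γ : K → Type) (σ : Type) : Type
  | skip : Prog Γ σ
  | push (k : K) (f : σ → Γ k) : Prog Γ σ
  | pop (k : K) (f : σ → Option (Γ k) → σ) : Prog Γ σ
  | seq (p q : Prog Γ σ) : Prog Γ σ
  | ite (c : σ → Bool) (p q : Prog Γ σ) : Prog Γ σ
  | loop (k : K) (f : σ → Option (Γ k) → σ) (c : σ → Bool) (p : Prog Γ σ) : Prog Γ σ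

namespace Prog

/-- The control points of a program, which become labels of a machine. -/
def Label : Prog Γ σ → Type
  | skip | push _ _ | pop _ _ => Unit
  | seq p q => Label p ⊕ Label q
  | ite _ p q => Option (Label p ⊕ Label q)
  | loop _ _ _ p => Option (Label p)

/-- The control point at which a program starts. -/
def entry : (p : Prog Γ σ) → Label p
  | skip | push _ _ | pop _ _ => ()
  | seq p _ => Sum.inl (entry p)
  | ite _ _ _ | loop _ _ _ _ => none

instance fintypeLabel : (p : Prog Γ σ) → Fintype (Label p)
  | skip | push _ _ | pop _ _ => inferInstanceAs (Fintype Unit)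
  | seq p q =>
    letI := fintypeLabel p
    letI := fintypeLabel q
    inferInstanceAs (Fintype (Label p ⊕ Label q))
  | ite _ p q =>
    letI := fintypeLabel p
    letI := fintypeLabel q
    inferInstanceAs (Fintype (Option (Label p ⊕ Label q)))
  | loop _ _ _ p =>
    letI := fintypeLabel p
    inferInstanceAs (Fintype (Option (Label p)))

/-- The machine statements at the control points of a program, for a machine in which the control
points are embedded by `emb` and which continues with `e` after the program. -/
def compile {Λ : Type} : (p : Prog Γ σ) → (emb : Label p → Λ) → (e : Λ) → Label p →
    TM2.Stmt Γ Λ σ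
  | skip, _, e => fun _ => .goto fun _ => e
  | push k f, _, e => fun _ => .push k f (.goto fun _ => e)
  | pop k f, _, e => fun _ => .pop k f (.goto fun _ => e)
  | seq p q, emb, e => fun
    | .inl l => compile p (emb ∘ .inl) (emb (.inr (entry q))) l
    | .inr l => compile q (emb ∘ .inr) e l
  | ite c p q, emb, e => fun
    | none => .branch c (.goto fun _ => emb (some (.inl (entry p))))
        (.goto fun _ => emb (some (.inr (entry q))))
    | some (.inl l) => compile p (emb ∘ some ∘ .inl) e l
    | some (.inr l) => compile q (emb ∘ some ∘ .inr) e l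
  | loop k f c p, emb, e => fun
    | none => .pop k f (.branch c (.goto fun _ => emb (some (entry p))) (.goto fun _ => e))
    | some l => compile p (emb ∘ some) (emb none) l

variable [DecidableEq K]

/-- `Run p v S t v' S'`: started with register `v` and stacks `S`, the program `p` ends with
register `v'` and stacks `S'` after at most `t` steps, in every machine containing it. -/
structure Run (p : Prog Γ σ) (v : σ) (S : ∀ k, List (Γ k)) (t : ℕ) (v' : σ)
    (S' : ∀ k, List (Γ k)) : Prop where
  evalsToInTime : ∀ {Λ : Type} (M : Λ → TM2.Stmt Γ Λ σ) (emb : Label p → Λ) (e : Λ),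
    (∀ l, M (emb l) = compile p emb e l) →
    Nonempty (EvalsToInTime (TM2.step M) ⟨some (emb (entry p)), v, S⟩ (some ⟨some e, v', S'⟩) t)

section Run

variable {p q : Prog Γ σ} {c : σ → Bool} {k : K} {f : σ → Option (Γ k) → σ} {v v' v'' : σ}
  {S S' S'' : ∀ k, List (Γ k)} {t t' : ℕ}

theorem evalsToInTime_one {Λ : Type} {M : Λ → TM2.Stmt Γ Λ σ} {l : Λ} {d : TM2.Cfg Γ Λ σ}
    (h : TM2.stepAux (M l) v S = d) :
    Nonempty (EvalsToInTime (TM2.step M) ⟨some l, v, S⟩ (some d) 1) :=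
  ⟨⟨⟨1, congrArg some h⟩, le_rfl⟩⟩

theorem Run.mono (h : Run p v S t v' S') (ht : t ≤ t') : Run p v S t' v' S' :=
  ⟨fun M emb e hM => (h.1 M emb e hM).map fun r => ⟨r.toEvalsTo, r.steps_le_m.trans ht⟩⟩

theorem Run.skip : Run (.skip : Prog Γ σ) v S 1 v S :=
  ⟨fun _ _ _ hM => evalsToInTime_one (by rw [hM]; rfl)⟩

theorem Run.push (g : σ → Γ k) :
    Run (.push k g) v S 1 v (Function.update S k (g v :: S k)) :=
  ⟨fun _ _ _ hM => evalsToInTime_one (by rw [hM]; rfl)⟩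

theorem Run.pop :
    Run (.pop k f) v S 1 (f v (S k).head?) (Function.update S k (S k).tail) :=
  ⟨fun _ _ _ hM => evalsToInTime_one (by rw [hM]; rfl)⟩

theorem Run.seq (hp : Run p v S t v' S') (hq : Run q v' S' t' v'' S'') :
    Run (.seq p q) v S (t + t') v'' S'' := by
  refine ⟨fun M emb e hM => ?_⟩
  obtain ⟨r⟩ := hp.1 M (emb ∘ .inl) (emb (.inr (entry q))) fun l => hM (.inl l)
  obtain ⟨r'⟩ := hq.1 M (emb ∘ .inr) e fun l => hM (.inr l)
  exact ⟨t.add_comm t' ▸ r.trans _ _ _ _ _ _ r'⟩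

theorem Run.ite_true (hc : c v = true) (hp : Run p v S t v' S') :
    Run (.ite c p q) v S (t + 1) v' S' := by
  refine ⟨fun M emb e hM => ?_⟩
  obtain ⟨r⟩ := hp.1 M (emb ∘ some ∘ .inl) e fun l => hM (some (.inl l))
  obtain ⟨r₀⟩ := evalsToInTime_one (M := M) (l := emb (entry _)) (v := v) (S := S)
    (d := ⟨some (emb (some (.inl (entry p)))), v, S⟩) (by rw [hM]; simp [entry, compile, hc])
  exact ⟨r₀.trans _ _ _ _ _ _ r⟩

theorem Run.ite_false (hc : c v = false) (hq : Run q v S t v' S') :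
    Run (.ite c p q) v S (t + 1) v' S' := by
  refine ⟨fun M emb e hM => ?_⟩
  obtain ⟨r⟩ := hq.1 M (emb ∘ some ∘ .inr) e fun l => hM (some (.inr l))
  obtain ⟨r₀⟩ := evalsToInTime_one (M := M) (l := emb (entry _)) (v := v) (S := S)
    (d := ⟨some (emb (some (.inr (entry q)))), v, S⟩) (by rw [hM]; simp [entry, compile, hc])
  exact ⟨r₀.trans _ _ _ _ _ _ r⟩

theorem Run.loop_true (hc : c (f v (S k).head?) = true)
    (hp : Run p (f v (S k).head?) (Function.update S k (S k).tail) t v' S')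
    (h : Run (.loop k f c p) v' S' t' v'' S'') :
    Run (.loop k f c p) v S (t + 1 + t') v'' S'' := by
  refine ⟨fun M emb e hM => ?_⟩
  obtain ⟨r⟩ := hp.1 M (emb ∘ some) (emb none) fun l => hM (some l)
  obtain ⟨r'⟩ := h.1 M emb e hM
  obtain ⟨r₀⟩ := evalsToInTime_one (M := M) (l := emb (entry _)) (v := v) (S := S)
    (d := ⟨some (emb (some (entry p))), f v (S k).head?, Function.update S k (S k).tail⟩)
    (by rw [hM]; simp [entry, compile, hc])
  exact ⟨(t + 1).add_comm t' ▸ (r₀.trans _ _ _ _ _ _ r).trans _ _ _ _ _ _ r'⟩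

theorem Run.loop_false (hc : c (f v (S k).head?) = false) :
    Run (.loop k f c p) v S 1 (f v (S k).head?) (Function.update S k (S k).tail) :=
  ⟨fun _ _ _ hM => evalsToInTime_one (by rw [hM]; simp [entry, compile, hc])⟩

end Run

/-- The machine which runs a program, resets the register and halts. -/
def machine [Fintype K] [Fintype σ] (p : Prog Γ σ) (k₀ k₁ : K) [Fintype (Γ k₀)] (v₀ : σ) :
    FinTM2 where
  K := K
  k₀ := k₀
  k₁ := k₁
  Γ := Γ
  Λ := Option (Label p)
  main := some (entry p)
  σ := σ
  initialState := v₀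
  m
    | none => .load (fun _ => v₀) .halt
    | some l => compile p some none l

/-- The family of stacks in which only `k` is nonempty, with content `l`. -/
def onlyStack (k : K) (l : List (Γ k)) : ∀ k, List (Γ k) := Function.update (fun _ => []) k l

theorem onlyStack_self (k : K) (l : List (Γ k)) : onlyStack k l k = l :=
  Function.update_self ..

theorem update_onlyStack (k : K) (l l' : List (Γ k)) :
    Function.update (onlyStack k l) k l' = onlyStack k l' :=
  Function.update_idem ..

theorem dite_eq_onlyStack (k₀ : K) (l : List (Γ k₀)) :
    (fun k => dite (k = k₀) (fun h => (congrArg (fun k => List (Γ k)) h).mpr l) fun _ => []) =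
      onlyStack k₀ l := by
  funext k
  obtain rfl | hk := eq_or_ne k k₀
  · simp [onlyStack]
  · simp [onlyStack, hk]

theorem initList_machine [Fintype K] [Fintype σ] (p : Prog Γ σ) (k₀ k₁ : K) [Fintype (Γ k₀)]
    (v₀ : σ) (l : List (Γ k₀)) :
    initList (machine p k₀ k₁ v₀) l = ⟨some (some (entry p)), v₀, onlyStack k₀ l⟩ :=
  congrArg (TM2.Cfg.mk _ _) (dite_eq_onlyStack k₀ l)

theorem haltList_machine [Fintype K] [Fintype σ] (p : Prog Γ σ) (k₀ k₁ : K) [Fintype (Γ k₀)]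
    (v₀ : σ) (l : List (Γ k₁)) :
    haltList (machine p k₀ k₁ v₀) l = ⟨none, v₀, onlyStack k₁ l⟩ :=
  congrArg (TM2.Cfg.mk _ _) (dite_eq_onlyStack k₁ l)

/-- A program which computes `g` within a polynomial number of steps makes `g` computable in
polynomial time. -/
noncomputable def polyTime [Fintype K] [Fintype σ] (p : Prog Γ σ) {k₀ k₁ : K}
    [Fintype (Γ k₀)] (v₀ : σ) {α β : Type} (ea : α → List (Γ k₀)) (eb : β → List (Γ k₁)) (g : α → β)
    (time : Polynomial ℕ)
    (h : ∀ a, ∃ v, Run p v₀ (onlyStack k₀ (ea a)) (time.eval (ea a).length) v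
      (onlyStack k₁ (eb (g a)))) :
    TM2ComputableInPolyTime ea eb g where
  tm := machine p k₀ k₁ v₀
  inputAlphabet := Equiv.refl _
  outputAlphabet := Equiv.refl _
  time := 1 + time
  outputsFun a := by
    apply Classical.choice
    obtain ⟨v, hv⟩ := h a
    obtain ⟨r⟩ := hv.1 (machine p k₀ k₁ v₀).m some none fun _ => rfl
    obtain ⟨r₁⟩ := evalsToInTime_one (M := (machine p k₀ k₁ v₀).m) (l := none) (v := v)
      (S := onlyStack k₁ (eb (g a))) (d := ⟨none, v₀, onlyStack k₁ (eb (g a))⟩) rfl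
    rw [TM2OutputsInTime, Option.map_some, Polynomial.eval_add, Polynomial.eval_one]
    erw [List.map_id, List.map_id, initList_machine p k₀ k₁ v₀ (ea a),
      haltList_machine p k₀ k₁ v₀ (eb (g a))]
    exact ⟨r.trans _ _ _ _ _ _ r₁⟩

end Prog

end StackPrograms

section RegularLanguages

variable {ρ : Type}

/-- The loop that feeds a stack to the automaton `M`; the register holds the state of `M` and
whether the stack was nonempty. -/
def dfaLoop (M : DFA Bool ρ) : Prog (fun _ : Unit => Bool) (ρ × Bool) :=
  .loop () (fun v o => (o.elim v.1 (M.step v.1), o.isSome)) (fun v => v.2) .skip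

theorem run_dfaLoop (M : DFA Bool ρ) (w : List Bool) (q : ρ) (b : Bool) :
    (dfaLoop M).Run (q, b) (Prog.onlyStack () w) (2 * w.length + 1) (M.evalFrom q w, false)
      (Prog.onlyStack () []) := by
  induction w generalizing q b with
  | nil => exact .loop_false rfl
  | cons a w ih =>
    have hstep : (dfaLoop M).Run (q, b) (Prog.onlyStack () (a :: w)) (1 + 1 + (2 * w.length + 1))
        (M.evalFrom (M.step q a) w, false) (Prog.onlyStack () []) :=
      .loop_true rfl .skip (by
        rw [Prog.update_onlyStack, Prog.onlyStack_self]
        exact ih (M.step q a) true)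
    exact hstep.mono (by rw [List.length_cons]; omega)

open Classical in
theorem polyTime_of_isRegular {L : Language Bool} (hL : L.IsRegular) :
    Nonempty (TM2ComputableInPolyTime (fun w : List Bool => w) Computability.encodeBool
      fun w => decide (w ∈ L)) := by
  obtain ⟨ρ, _, M, rfl⟩ := hL
  refine ⟨Prog.polyTime (.seq (dfaLoop M) (.push () fun v => decide (v.1 ∈ M.accept)))
    (k₀ := ()) (k₁ := ()) (M.start, false) _ _ _ (2 * .X + 1 + 1) fun w => ⟨(M.eval w, false), ?_⟩⟩
  have hpush := (run_dfaLoop M w M.start false).seq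
    (.push (k := ()) fun v => decide (v.1 ∈ M.accept))
  simpa [Prog.update_onlyStack, Prog.onlyStack_self, DFA.mem_accepts, DFA.eval,
    Computability.encodeBool] using hpush

end RegularLanguages

section Words

/-- The reflection of the interval `[0, m]`, fixing all larger numbers. -/
def reflect (m c : ℕ) : ℕ := if c ≤ m then m - c else c

theorem reflect_reflect (m c : ℕ) : reflect m (reflect m c) = c := by
  grind [reflect]

theorem reflect_le (m c : ℕ) : reflect m c ≤ m + c := by
  grind [reflect]

/-- The word `0ᵃ` or `z10ᵃ`. -/
def joinZeros : Option (List Bool) → ℕ → List Bool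
  | none, a => List.replicate a false
  | some z, a => z ++ true :: List.replicate a false

/-- The inverse of `joinZeros`: what precedes the last `1` of a word, if there is any, and the
number of zeros at its end. -/
def splitZeros : List Bool → Option (List Bool) × ℕ
  | [] => (none, 0)
  | b :: w =>
    match b, splitZeros w with
    | b, (some z, a) => (some (b :: z), a)
    | true, (none, a) => (some [], a)
    | false, (none, a) => (none, a + 1)

theorem joinZeros_splitZeros (w : List Bool) :
    joinZeros (splitZeros w).1 (splitZeros w).2 = w := by
  fun_induction splitZeros w <;> simp_all [joinZeros, List.replicate_succ]

theorem splitZeros_joinZeros (z : Option (List Bool)) (a : ℕ) :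
    splitZeros (joinZeros z a) = (z, a) := by
  have hnone : splitZeros (List.replicate a false) = (none, a) := by
    induction a with
    | zero => rfl
    | succ a ih => simp [List.replicate_succ, splitZeros, ih]
  cases z with
  | none => exact hnone
  | some z =>
    induction z with
    | nil => simp [joinZeros, splitZeros, hnone]
    | cons b z ih => simp_all [joinZeros, splitZeros]

/-- The number of zeros at the end of an output after coding or decoding: it is reflected for words
that contain a `1`. -/
def reflectZeros (m : ℕ) (z : Option (List Bool)) (b : ℕ) : ℕ := z.elim b fun _ => reflect m b

theorem reflectZeros_reflectZeros (m : ℕ) (z : Option (List Bool)) (b : ℕ) :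
    reflectZeros m z (reflectZeros m z b) = b := by
  cases z
  · rfl
  · exact reflect_reflect m b

/-- The coding of a pair of a target state and an output by a word, for transducers with `n` states:
the target is absorbed into the number of zeros at the end. -/
def pairEquiv (n : ℕ) [NeZero n] : Fin n × List Bool ≃ List Bool where
  toFun p :=
    let (z, b) := splitZeros p.2
    joinZeros z (n * reflectZeros (n ^ 2) z b + p.1)
  invFun u :=
    let (z, a) := splitZeros u
    (Fin.ofNat n a, joinZeros z (reflectZeros (n ^ 2) z (a / n)))
  left_inv p := by
    refine Prod.ext (Fin.ext ?_) ?_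
    · simp [splitZeros_joinZeros, Nat.mod_eq_of_lt]
    · simp [splitZeros_joinZeros, Nat.mul_add_div (NeZero.pos n), Nat.div_eq_of_lt,
        reflectZeros_reflectZeros, joinZeros_splitZeros]
  right_inv u := by
    simp [splitZeros_joinZeros, reflectZeros_reflectZeros, Nat.div_add_mod, joinZeros_splitZeros]

theorem pairEquiv_joinZeros (n : ℕ) [NeZero n] (t : Fin n) (z : Option (List Bool)) (b : ℕ) :
    pairEquiv n (t, joinZeros z b) = joinZeros z (n * reflectZeros (n ^ 2) z b + t) := by
  simp [pairEquiv, splitZeros_joinZeros]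

theorem pairEquiv_symm_joinZeros (n : ℕ) [NeZero n] (z : Option (List Bool)) (a : ℕ) :
    (pairEquiv n).symm (joinZeros z a) =
      (Fin.ofNat n a, joinZeros z (reflectZeros (n ^ 2) z (a / n))) := by
  simp [pairEquiv, splitZeros_joinZeros]

theorem length_snd_pairEquiv_symm_le (n : ℕ) [NeZero n] (u : List Bool) :
    ((pairEquiv n).symm u).2.length ≤
      u.length + n ^ 2 * ((pairEquiv n).symm u).2.count true := by
  rw [← joinZeros_splitZeros u, pairEquiv_symm_joinZeros]
  obtain ⟨z, a⟩ := splitZeros u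
  have hdiv : a / n ≤ a := Nat.div_le_self a n
  cases z with
  | none => simpa [joinZeros, reflectZeros, List.count_replicate] using hdiv
  | some z =>
    have hreflect := reflect_le (n ^ 2) (a / n)
    simp only [joinZeros, reflectZeros, Option.elim_some, List.length_append, List.length_cons,
      List.length_replicate, List.count_append, List.count_cons_self]
    nlinarith [Nat.zero_le (n ^ 2 * z.count true),
      Nat.zero_le (n ^ 2 * (List.replicate (reflect (n ^ 2) (a / n)) false).count true)]

theorem count_snd_pairEquiv_symm_le (n : ℕ) [NeZero n] (u : List Bool) :
    ((pairEquiv n).symm u).2.count true ≤ u.length := by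
  rw [← joinZeros_splitZeros u, pairEquiv_symm_joinZeros]
  obtain ⟨z, a⟩ := splitZeros u
  cases z with
  | none => simp [joinZeros, List.count_replicate]
  | some z =>
    have hz : z.count true ≤ z.length := List.count_le_length
    simp only [joinZeros, List.count_append, List.count_cons_self, List.count_replicate,
      List.length_append, List.length_cons, List.length_replicate]
    simp only [beq_iff_eq, Bool.false_eq_true, if_false]
    omega

end Words

section Serialization

/-- The bits of a word over `{0, 1, #}`: the separator `#` is written as `0`, a letter `b` as
`1b`. -/
def bits : List (Option Bool) → List Bool
  | [] => []
  | none :: l => false :: bits l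
  | some b :: l => true :: b :: bits l

theorem bits_injective : Function.Injective bits := by
  intro l l' h
  fun_induction bits l generalizing l' <;> rcases l' with _ | ⟨_ | b', l'⟩ <;> grind [bits]

/-- The words `u` and `v`, each preceded by a separator. -/
def rowSymbols (r : List Bool × List Bool) : List (Option Bool) :=
  none :: r.1.map some ++ none :: r.2.map some

/-- The word before the first separator, and the list of the words after the separators. -/
def splitAtSeparators : List (Option Bool) → List Bool × List (List Bool)
  | [] => ([], [])
  | none :: l => ([], (splitAtSeparators l).1 :: (splitAtSeparators l).2)
  | some b :: l => (b :: (splitAtSeparators l).1, (splitAtSeparators l).2)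

theorem splitAtSeparators_map_some_append (u : List Bool) (l : List (Option Bool)) :
    splitAtSeparators (u.map some ++ l) =
      (u ++ (splitAtSeparators l).1, (splitAtSeparators l).2) := by
  induction u with
  | nil => rfl
  | cons b u ih => simp [splitAtSeparators, ih]

theorem flatMap_rowSymbols_injective :
    Function.Injective fun rs : List (List Bool × List Bool) => rs.flatMap rowSymbols := by
  have hsplit : ∀ rs : List (List Bool × List Bool),
      splitAtSeparators (rs.flatMap rowSymbols) = ([], rs.flatMap fun r => [r.1, r.2]) := by
    intro rs
    induction rs with
    | nil => rfl
    | cons r rs ih => simp [rowSymbols, splitAtSeparators, splitAtSeparators_map_some_append, ih]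
  intro rs rs' h
  have hwords := congrArg (fun l => (splitAtSeparators l).2) h
  simp only [hsplit] at hwords
  clear h
  induction rs generalizing rs' with
  | nil => cases rs' <;> simp_all
  | cons r rs ih =>
    cases rs' with
    | nil => simp at hwords
    | cons r' rs' =>
      simp only [List.flatMap_cons, List.cons_append, List.nil_append, List.cons.injEq] at hwords
      rw [ih hwords.2.2, Prod.ext hwords.1 hwords.2.1]

theorem exists_rows_of_odd_count {l : List (Option Bool)} (h : Odd (l.count none)) :
    ∃ rs ≠ [], none :: l = rs.flatMap rowSymbols := by
  suffices ∀ l : List (Option Bool),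
      (Even (l.count none) → ∃ (u : List Bool) (rs : List (List Bool × List Bool)),
        l = u.map some ++ rs.flatMap rowSymbols) ∧
      (Odd (l.count none) → ∃ (u v : List Bool) (rs : List (List Bool × List Bool)),
        l = u.map some ++ none :: v.map some ++ rs.flatMap rowSymbols) by
    obtain ⟨u, v, rs, rfl⟩ := (this l).2 h
    exact ⟨(u, v) :: rs, List.cons_ne_nil _ _, by simp [rowSymbols]⟩
  intro l
  induction l with
  | nil => exact ⟨fun _ => ⟨[], [], rfl⟩, fun h => by simp at h⟩
  | cons x l ih =>
    obtain ⟨heven, hodd⟩ := ih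
    rcases x with _ | b
    · simp only [List.count_cons_self, Nat.even_add_one, Nat.odd_add_one, Nat.not_even_iff_odd,
        Nat.not_odd_iff_even]
      constructor
      · intro h
        obtain ⟨u, v, rs, rfl⟩ := hodd h
        exact ⟨[], (u, v) :: rs, by simp [rowSymbols]⟩
      · intro h
        obtain ⟨v, rs, rfl⟩ := heven h
        exact ⟨[], v, rs, by simp⟩
    · simp only [List.count_cons_of_ne (Option.some_ne_none b)]
      constructor
      · intro h
        obtain ⟨u, rs, rfl⟩ := heven h
        exact ⟨b :: u, rs, rfl⟩
      · intro h
        obtain ⟨u, v, rs, rfl⟩ := hodd h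
        exact ⟨b :: u, v, rs, rfl⟩

end Serialization

namespace Transducer

variable (T : Transducer)

instance : NeZero T.numStates := ⟨T.pos.ne'⟩

/-- The word that codes the transition with source `q` and input letter `i`. -/
def pairCode (q : Fin T.numStates) (i : Bool) : List Bool := pairEquiv T.numStates (T.Δ q i)

/-- The codes of the transitions, state by state. -/
def rows : List (List Bool × List Bool) :=
  List.ofFn fun q => (T.pairCode q false, T.pairCode q true)

/-- The codes of the transitions as one word over `{0, 1, #}`. -/
def symbols : List (Option Bool) := T.rows.flatMap rowSymbols

/-- The code of a transducer. The first separator is left out, since it carries no information. -/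
def code : List Bool := bits T.symbols.tail

theorem rows_ne_nil : T.rows ≠ [] := by
  rw [← List.length_pos_iff, rows, List.length_ofFn]
  exact T.pos

theorem none_cons_tail_symbols : none :: T.symbols.tail = T.symbols := by
  obtain ⟨r, rs, hrs⟩ := List.exists_cons_of_ne_nil T.rows_ne_nil
  simp [symbols, hrs, rowSymbols]

theorem count_none_symbols : T.symbols.count none = 2 * T.numStates := by
  have hmap : ∀ u : List Bool, (u.map some).count none = 0 := by simp [List.count_eq_zero]
  simp [symbols, rows, List.count_flatMap, rowSymbols, Function.comp_def, hmap, mul_comm]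

/-- The transducer with the transitions that are coded by given words. -/
def ofRows (rs : List (List Bool × List Bool)) [NeZero rs.length] : Transducer where
  numStates := rs.length
  pos := NeZero.pos _
  Δ q i := (pairEquiv rs.length).symm (bif i then rs[q].2 else rs[q].1)

theorem rows_ofRows (rs : List (List Bool × List Bool)) [NeZero rs.length] :
    (ofRows rs).rows = rs := by
  simp only [rows, pairCode, ofRows, cond_false, cond_true]
  erw [funext fun q => congrArg₂ Prod.mk ((pairEquiv _).apply_symm_apply _)
    ((pairEquiv _).apply_symm_apply _)]
  exact List.ofFn_getElem ..

theorem rows_injective : Function.Injective rows := by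
  rintro ⟨n, hn, Δ⟩ ⟨m, hm, Δ'⟩ h
  obtain rfl : n = m := by simpa [rows] using congrArg List.length h
  have : NeZero n := ⟨hn.ne'⟩
  have hrow := congrFun (List.ofFn_injective h)
  congr
  funext q i
  cases i
  · exact (pairEquiv n).injective (congrArg Prod.fst (hrow q))
  · exact (pairEquiv n).injective (congrArg Prod.snd (hrow q))

theorem code_injective : Function.Injective code := by
  intro T T' h
  apply rows_injective
  apply flatMap_rowSymbols_injective
  change T.symbols = T'.symbols
  rw [← T.none_cons_tail_symbols, ← T'.none_cons_tail_symbols, bits_injective h]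

theorem mem_range_code {w : List Bool} :
    w ∈ Set.range code ↔ ∃ l, Odd (l.count none) ∧ w = bits l := by
  constructor
  · rintro ⟨T, rfl⟩
    refine ⟨T.symbols.tail, ?_, rfl⟩
    have hcount := T.count_none_symbols
    rw [← none_cons_tail_symbols, List.count_cons_self] at hcount
    exact ⟨T.numStates - 1, by have := T.pos; omega⟩
  · rintro ⟨l, hl, rfl⟩
    obtain ⟨rs, hrs, hl⟩ := exists_rows_of_odd_count hl
    have : NeZero rs.length := ⟨List.length_eq_zero_iff.not.2 hrs⟩
    exact ⟨ofRows rs, by rw [code, symbols, rows_ofRows, ← hl, List.tail_cons]⟩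

end Transducer

/-- The encoding of all transducers by their codes. -/
noncomputable def runEncoding : Encoding where
  dom := Set.range Transducer.code
  decode := (Equiv.ofInjective _ Transducer.code_injective).symm
  bijective := Equiv.bijective _

theorem code_decode_runEncoding (c : runEncoding.dom) : (runEncoding.decode c).code = c :=
  Equiv.apply_ofInjective_symm Transducer.code_injective c

section Domain

/-- The automaton that decides whether a word is `bits l` with an odd number of separators in `l`.
Its state holds the parity of the number of separators, and whether the second bit of a letter is
expected. -/
def oddDFA : DFA Bool (Bool × Bool) where
  step
    | (o, false), false => (!o, false)
    | (o, false), true => (o, true)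
    | (o, true), _ => (o, false)
  start := (false, false)
  accept := {(true, false)}

theorem evalFrom_oddDFA_bits (l : List (Option Bool)) (o : Bool) :
    oddDFA.evalFrom (o, false) (bits l) = (o ^^ decide (Odd (l.count none)), false) := by
  fun_induction bits l generalizing o with
  | case1 => simp
  | case2 l ih =>
    refine (ih (!o)).trans ?_
    simp [Nat.odd_add_one, -Nat.not_odd_iff_even]
  | case3 b l ih =>
    rw [List.count_cons_of_ne (Option.some_ne_none b)]
    exact ih o

theorem exists_bits_of_evalFrom_oddDFA : ∀ {w : List Bool} {o o' : Bool},
    oddDFA.evalFrom (o, false) w = (o', false) → ∃ l, w = bits l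
  | [], _, _, _ => ⟨[], rfl⟩
  | [true], o, _, h => by simp [oddDFA] at h
  | false :: w, _, _, h => by
    obtain ⟨l, rfl⟩ := exists_bits_of_evalFrom_oddDFA (w := w) h
    exact ⟨none :: l, rfl⟩
  | true :: b :: w, _, _, h => by
    obtain ⟨l, rfl⟩ := exists_bits_of_evalFrom_oddDFA (w := w) h
    exact ⟨some b :: l, rfl⟩

theorem isRegular_range_code : Language.IsRegular (Set.range Transducer.code) := by
  refine ⟨_, inferInstance, oddDFA, Set.ext fun w => ?_⟩
  rw [Transducer.mem_range_code]
  have hbits : ∀ l, oddDFA.eval (bits l) = (true, false) ↔ Odd (l.count none) := fun l => by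
    change oddDFA.evalFrom (false, false) (bits l) = _ ↔ _
    simp [evalFrom_oddDFA_bits]
  constructor
  · intro h
    obtain ⟨l, rfl⟩ := exists_bits_of_evalFrom_oddDFA (Set.mem_singleton_iff.1 h)
    exact ⟨l, (hbits l).1 h, rfl⟩
  · rintro ⟨l, hl, rfl⟩
    exact (hbits l).2 hl

end Domain

section Hierarchy

theorem length_bits_add_count (l : List (Option Bool)) :
    (bits l).length + l.count none = 2 * l.length := by
  fun_induction bits l <;> simp_all <;> omega

namespace Transducer

variable (T : Transducer)

/-- The number of letters of a code, not counting separators. -/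
def weight : ℕ := ∑ q, ∑ i, (T.pairCode q i).length

theorem length_symbols : T.symbols.length = 2 * T.numStates + T.weight := by
  simp only [symbols, rows, weight, List.length_flatMap, rowSymbols, List.cons_append,
    List.length_cons, List.length_append, List.length_map, List.map_ofFn, Function.comp_def,
    List.sum_ofFn, Finset.sum_add_distrib, Finset.sum_const, Finset.card_univ, Fintype.card_fin,
    smul_eq_mul, mul_one, Fintype.univ_bool, Finset.mem_singleton, Bool.true_eq_false,
    not_false_eq_true, Finset.sum_insert, Finset.sum_singleton]
  omega

theorem length_code_add_one : T.code.length + 1 = 2 * T.numStates + 2 * T.weight := by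
  have hbits := length_bits_add_count T.symbols
  rw [← T.none_cons_tail_symbols, bits, List.length_cons, none_cons_tail_symbols, length_symbols,
    count_none_symbols, ← code] at hbits
  omega

theorem length_pairCode_le_weight (q : Fin T.numStates) (i : Bool) :
    (T.pairCode q i).length ≤ T.weight :=
  (Finset.single_le_sum (f := fun i => (T.pairCode q i).length) (fun _ _ => Nat.zero_le _)
    (Finset.mem_univ i)).trans
    (Finset.single_le_sum (f := fun q => ∑ i, (T.pairCode q i).length) (fun _ _ => Nat.zero_le _)
      (Finset.mem_univ q))

theorem length_runFrom_le (q : Fin T.numStates) (p : List Bool) :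
    (T.runFrom q p).length ≤
      T.weight * p.length + T.numStates ^ 2 * (T.runFrom q p).count true := by
  induction p generalizing q with
  | nil => simp [runFrom]
  | cons i p ih =>
    have hletter := length_snd_pairEquiv_symm_le T.numStates (T.pairCode q i)
    rw [pairCode, Equiv.symm_apply_apply, ← pairCode] at hletter
    have hweight := T.length_pairCode_le_weight q i
    have hword := ih (T.Δ q i).1
    simp only [runFrom, List.length_append, List.count_append, List.length_cons]
    linarith

theorem count_runFrom_le (q : Fin T.numStates) (p : List Bool) :
    (T.runFrom q p).count true ≤ T.weight * p.length := by
  induction p generalizing q with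
  | nil => simp [runFrom]
  | cons i p ih =>
    have hletter := count_snd_pairEquiv_symm_le T.numStates (T.pairCode q i)
    rw [pairCode, Equiv.symm_apply_apply, ← pairCode] at hletter
    have hweight := T.length_pairCode_le_weight q i
    have hword := ih (T.Δ q i).1
    simp only [runFrom, List.count_append, List.length_cons]
    linarith

end Transducer

/-- The word `10ᵐ` with `m = n²`, whose minimal descriptions use `n` states. -/
def oneLongRun (n : ℕ) : List Bool := joinZeros (some []) (n ^ 2)

/-- The transducer with `n` states that outputs `oneLongRun n` on the letter `0` in its start
state, and nothing else. -/
def longRunTransducer (n : ℕ) [NeZero n] : Transducer where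
  numStates := n
  pos := NeZero.pos n
  Δ q i := (0, if q = 0 ∧ i = false then oneLongRun n else [])

theorem run_longRunTransducer (n : ℕ) [NeZero n] :
    (longRunTransducer n).run [false] = oneLongRun n := by
  simp [Transducer.run, Transducer.runFrom, longRunTransducer, Transducer.start]

theorem pairEquiv_zero_nil (n : ℕ) [NeZero n] : pairEquiv n (0, []) = [] := by
  simpa [reflectZeros, joinZeros] using pairEquiv_joinZeros n 0 none 0

theorem pairEquiv_zero_oneLongRun (n : ℕ) [NeZero n] : pairEquiv n (0, oneLongRun n) = [true] := by
  rw [oneLongRun, pairEquiv_joinZeros]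
  simp [reflectZeros, reflect, joinZeros]

theorem weight_longRunTransducer (n : ℕ) [NeZero n] : (longRunTransducer n).weight = 1 := by
  have hcode : ∀ (q : Fin n) (i : Bool), ((longRunTransducer n).pairCode q i).length =
      if q = 0 then if i = false then 1 else 0 else 0 := by
    intro q i
    change (pairEquiv n (0, if q = 0 ∧ i = false then oneLongRun n else [])).length = _
    split_ifs <;> simp_all [pairEquiv_zero_nil, pairEquiv_zero_oneLongRun]
  change ∑ q : Fin n, ∑ i, ((longRunTransducer n).pairCode q i).length = 1
  simp [hcode]

theorem length_code_longRunTransducer (n : ℕ) [NeZero n] :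
    (longRunTransducer n).code.length = 2 * n + 1 := by
  have hlen := (longRunTransducer n).length_code_add_one
  rw [weight_longRunTransducer] at hlen
  change _ = 2 * n + 2 * 1 at hlen
  omega

theorem two_mul_add_lt_of_sq_lt {m n e k : ℕ} (hm : 0 < m) (hmn : m < n)
    (h : n ^ 2 + 1 ≤ e * k + m ^ 2) : 2 * n + 3 < 2 * m + 2 * e + k := by
  by_contra! hle
  obtain ⟨d, rfl⟩ := Nat.exists_eq_add_of_lt hmn
  have hsum : 2 * e + k ≤ 2 * d + 5 := by omega
  have hsq : (2 * e + k) ^ 2 ≤ (2 * d + 5) ^ 2 := Nat.pow_le_pow_left hsum 2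
  have hamgm : 8 * (e * k) ≤ (2 * e + k) ^ 2 := by
    zify
    linarith [sq_nonneg (2 * (e : ℤ) - k)]
  nlinarith [Nat.zero_le (m * d)]

theorem lt_length_of_run_eq_oneLongRun {T : Transducer} {p : List Bool} {n : ℕ}
    (h : T.run p = oneLongRun n) (hT : T.numStates ≠ n) :
    2 * n + 2 < T.code.length + p.length := by
  have hcount := T.count_runFrom_le T.start p
  have hlen := T.length_runFrom_le T.start p
  have hcode := T.length_code_add_one
  rw [← Transducer.run, h] at hcount hlen
  have htrue : (oneLongRun n).count true = 1 := by
    simp [oneLongRun, joinZeros, List.count_replicate]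
  rw [htrue] at hcount hlen
  have hlength : (oneLongRun n).length = n ^ 2 + 1 := by simp [oneLongRun, joinZeros]
  rw [hlength] at hlen
  rcases lt_or_gt_of_ne hT with hlt | hgt
  · rw [mul_one] at hlen
    have := two_mul_add_lt_of_sq_lt T.pos hlt hlen
    omega
  · have hweight : T.weight ≠ 0 := fun h => by simp [h] at hcount
    have hp : p.length ≠ 0 := fun h => by simp [h] at hcount
    omega

theorem exists_minimal_description (S : Encoding) {T : Transducer} {p x : List Bool}
    (h : T.run p = x) : ∃ (c : S.dom) (p : List Bool), (S.decode c).run p = x ∧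
      (c : List Bool).length + p.length = S.complexity x := by
  obtain ⟨c, rfl⟩ := S.bijective.2 T
  exact Nat.sInf_mem (s := {k | ∃ (c : S.dom) (p : List Bool), (S.decode c).run p = x ∧
    (c : List Bool).length + p.length = k}) ⟨_, c, p, h, rfl⟩

theorem complexity_runEncoding_run_le (T : Transducer) (p : List Bool) :
    runEncoding.complexity (T.run p) ≤ T.code.length + p.length := by
  obtain ⟨c, rfl⟩ := runEncoding.bijective.2 T
  exact Nat.sInf_le ⟨c, p, rfl, by rw [code_decode_runEncoding]⟩

theorem numStates_of_minimal {n : ℕ} [NeZero n] {c : runEncoding.dom} {p : List Bool}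
    (hrun : (runEncoding.decode c).run p = oneLongRun n)
    (hlen : (c : List Bool).length + p.length = runEncoding.complexity (oneLongRun n)) :
    (runEncoding.decode c).numStates = n := by
  by_contra hne
  have hlt := lt_length_of_run_eq_oneLongRun hrun hne
  have hle := complexity_runEncoding_run_le (longRunTransducer n) [false]
  rw [run_longRunTransducer, length_code_longRunTransducer, ← hlen, ← code_decode_runEncoding,
    List.length_singleton] at hle
  omega

theorem level_runEncoding_ssubset {n : ℕ} (hn : 1 ≤ n) :
    runEncoding.level (n - 1) ⊂ runEncoding.level n := by
  have : NeZero n := ⟨by omega⟩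
  refine ⟨fun x ⟨c, p, hrun, hlen, hstates⟩ => ⟨c, p, hrun, hlen, by omega⟩, fun hsub => ?_⟩
  obtain ⟨c, p, hrun, hlen⟩ :=
    exists_minimal_description runEncoding (run_longRunTransducer n)
  obtain ⟨c', p', hrun', hlen', hstates⟩ :=
    hsub ⟨c, p, hrun, hlen, (numStates_of_minimal hrun hlen).le⟩
  have := numStates_of_minimal hrun' hlen'
  omega

end Hierarchy

section Store

/-- The unary counters of the decoder. -/
inductive Counter
  | states | source | zeros | rem | quot | square | scratch | value | odd | excess
  deriving DecidableEq

instance : Fintype Counter where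
  elems := {.states, .source, .zeros, .rem, .quot, .square, .scratch, .value, .odd, .excess}
  complete i := by cases i <;> simp

/-- The stacks of the decoder: its input, its output, a buffer and the counters. -/
inductive Stack
  | inp
  | out
  | buf
  | counter (i : Counter)
  deriving DecidableEq, Fintype

/-- The alphabets of the stacks of the decoder. -/
abbrev Stack.Sym : Stack → Type
  | inp => Bool
  | out | buf => Option Bool
  | counter _ => Unit

/-- The contents of the stacks of the decoder, with the numbers that the counters stand for. -/
structure Store where
  inp : List Bool := []
  out : List (Option Bool) := []
  buf : List (Option Bool) := []
  states : ℕ := 0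
  source : ℕ := 0
  zeros : ℕ := 0
  rem : ℕ := 0
  quot : ℕ := 0
  square : ℕ := 0
  scratch : ℕ := 0
  value : ℕ := 0
  odd : ℕ := 0
  excess : ℕ := 0

namespace Store

/-- The value of a counter. -/
def get (s : Store) : Counter → ℕ
  | .states => s.states
  | .source => s.source
  | .zeros => s.zeros
  | .rem => s.rem
  | .quot => s.quot
  | .square => s.square
  | .scratch => s.scratch
  | .value => s.value
  | .odd => s.odd
  | .excess => s.excess

/-- The store in which the value of a counter is replaced. -/
def set (s : Store) (i : Counter) (m : ℕ) : Store :=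
  match i with
  | .states => { s with states := m }
  | .source => { s with source := m }
  | .zeros => { s with zeros := m }
  | .rem => { s with rem := m }
  | .quot => { s with quot := m }
  | .square => { s with square := m }
  | .scratch => { s with scratch := m }
  | .value => { s with value := m }
  | .odd => { s with odd := m }
  | .excess => { s with excess := m }

/-- The stacks described by a store. -/
def toStacks (s : Store) : ∀ k : Stack, List k.Sym
  | .inp => s.inp
  | .out => s.out
  | .buf => s.buf
  | .counter i => List.replicate (s.get i) ()

theorem get_set (s : Store) (i : Counter) (m : ℕ) : (s.set i m).get i = m := by cases i <;> rfl

theorem set_set (s : Store) (i : Counter) (m m' : ℕ) : (s.set i m).set i m' = s.set i m' := by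
  cases i <;> rfl

theorem get_set_of_ne (s : Store) {i j : Counter} (hij : i ≠ j) (m : ℕ) :
    (s.set i m).get j = s.get j := by
  cases i <;> cases j <;> first | rfl | exact absurd rfl hij

theorem set_comm (s : Store) {i j : Counter} (hij : i ≠ j) (m m' : ℕ) :
    (s.set i m).set j m' = (s.set j m').set i m := by
  cases i <;> cases j <;> first | rfl | exact absurd rfl hij

theorem set_get (s : Store) (i : Counter) : s.set i (s.get i) = s := by cases i <;> rfl

theorem update_counter (s : Store) (i : Counter) (l : List Unit) :
    Function.update s.toStacks (.counter i) l = (s.set i l.length).toStacks := by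
  funext k
  obtain rfl | hk := eq_or_ne k (.counter i)
  · rw [Function.update_self, toStacks, get_set]
    exact List.eq_replicate_iff.2 ⟨rfl, fun _ _ => rfl⟩
  · rw [Function.update_of_ne hk]
    cases k with
    | counter j => rw [toStacks, toStacks, get_set_of_ne _ fun h => hk (congrArg _ h.symm)]
    | _ => cases i <;> rfl

theorem update_inp (s : Store) (l : List Bool) :
    Function.update s.toStacks .inp l = { s with inp := l }.toStacks := by
  funext k
  cases k <;> rfl

theorem update_out (s : Store) (l : List (Option Bool)) :
    Function.update s.toStacks .out l = { s with out := l }.toStacks := by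
  funext k
  cases k <;> rfl

theorem update_buf (s : Store) (l : List (Option Bool)) :
    Function.update s.toStacks .buf l = { s with buf := l }.toStacks := by
  funext k
  cases k <;> rfl

end Store

/-- The programs of the decoder. The register holds the last symbol read. -/
abbrev StoreProg : Type := Prog Stack.Sym (Option Bool)

/-- `Exec p s t s'`: started with the store `s`, the program `p` ends with the store `s'` after at
most `t` steps, whatever the register holds. -/
structure Exec (p : StoreProg) (s : Store) (t : ℕ) (s' : Store) : Prop where
  exists_run : ∀ v, ∃ v', p.Run v s.toStacks t v' s'.toStacks

/-- Add `1` to a counter. -/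
def mark (i : Counter) : StoreProg := .push (.counter i) fun _ => ()

/-- Write a symbol. -/
def emit (x : Option Bool) : StoreProg := .push .out fun _ => x

/-- Subtract `1` from a counter and run `p`, or run `q` if the counter is zero. -/
def ifCounter (i : Counter) (p q : StoreProg) : StoreProg :=
  .seq (.pop (.counter i) fun _ o => o.map fun _ => true) (.ite Option.isSome p q)

/-- As long as a counter is nonzero, subtract `1` from it and run `p`. -/
def forCounter (i : Counter) (p : StoreProg) : StoreProg :=
  .loop (.counter i) (fun _ o => o.map fun _ => true) Option.isSome p

variable {p q : StoreProg} {s s' s'' : Store} {t t' m : ℕ} {i : Counter}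

theorem Exec.mono (h : Exec p s t s') (ht : t ≤ t') : Exec p s t' s' :=
  ⟨fun v => (h.1 v).imp fun _ hv => hv.mono ht⟩

theorem Exec.congr (h : Exec p s t s') (hs : s' = s'') (ht : t ≤ t') : Exec p s t' s'' :=
  hs ▸ h.mono ht

theorem Exec.seq (h : Exec p s t s') (h' : Exec q s' t' s'') : Exec (.seq p q) s (t + t') s'' := by
  refine ⟨fun v => ?_⟩
  obtain ⟨v', hv'⟩ := h.1 v
  obtain ⟨v'', hv''⟩ := h'.1 v'
  exact ⟨v'', hv'.seq hv''⟩

theorem exec_skip (s : Store) : Exec .skip s 1 s := ⟨fun v => ⟨v, .skip⟩⟩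

theorem exec_mark (i : Counter) (s : Store) : Exec (mark i) s 1 (s.set i (s.get i + 1)) := by
  refine ⟨fun v => ⟨v, ?_⟩⟩
  have hpush := Prog.Run.push (Γ := Stack.Sym) (k := .counter i) (v := v) (S := s.toStacks)
    fun _ => ()
  rwa [Store.update_counter, List.length_cons, Store.toStacks, List.length_replicate] at hpush

theorem exec_emit (x : Option Bool) (s : Store) :
    Exec (emit x) s 1 { s with out := x :: s.out } := by
  refine ⟨fun v => ⟨v, ?_⟩⟩
  have hpush := Prog.Run.push (Γ := Stack.Sym) (k := .out) (v := v) (S := s.toStacks) fun _ => x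
  rwa [Store.update_out] at hpush

theorem update_tail_counter (s : Store) (i : Counter) :
    Function.update s.toStacks (.counter i) (s.toStacks (.counter i)).tail =
      (s.set i (s.get i - 1)).toStacks := by
  rw [Store.update_counter, List.length_tail, Store.toStacks, List.length_replicate]

theorem map_head_counter_zero (hs : s.get i = 0) :
    (s.toStacks (.counter i)).head?.map (fun _ => true) = none := by
  simp [Store.toStacks, hs]

theorem map_head_counter_succ (hs : s.get i = m + 1) :
    (s.toStacks (.counter i)).head?.map (fun _ => true) = some true := by
  simp [Store.toStacks, hs, List.replicate_succ]

theorem exec_ifCounter_zero (hs : s.get i = 0) (hq : Exec q s t s') :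
    Exec (ifCounter i p q) s (t + 2) s' := by
  refine ⟨fun v => ?_⟩
  obtain ⟨v', hv'⟩ := hq.1 none
  have hpop := Prog.Run.pop (k := .counter i) (f := fun _ o => o.map fun _ => true) (v := v)
    (S := s.toStacks)
  rw [map_head_counter_zero hs, update_tail_counter, hs, Nat.zero_sub, ← hs, Store.set_get] at hpop
  exact ⟨v', (hpop.seq (.ite_false rfl hv')).mono (by omega)⟩

theorem exec_ifCounter_succ (hs : s.get i = m + 1) (hp : Exec p (s.set i m) t s') :
    Exec (ifCounter i p q) s (t + 2) s' := by
  refine ⟨fun v => ?_⟩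
  obtain ⟨v', hv'⟩ := hp.1 (some true)
  have hpop := Prog.Run.pop (k := .counter i) (f := fun _ o => o.map fun _ => true) (v := v)
    (S := s.toStacks)
  rw [map_head_counter_succ hs, update_tail_counter, hs, Nat.add_sub_cancel] at hpop
  exact ⟨v', (hpop.seq (.ite_true rfl hv')).mono (by omega)⟩

theorem exec_forCounter_zero (hs : s.get i = 0) : Exec (forCounter i p) s 1 s := by
  refine ⟨fun v => ⟨none, ?_⟩⟩
  have hloop := Prog.Run.loop_false (k := .counter i) (f := fun _ o => o.map fun _ => true)
    (c := Option.isSome) (p := p) (v := v) (S := s.toStacks) (by rw [map_head_counter_zero hs]; rfl)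
  rwa [map_head_counter_zero hs, update_tail_counter, hs, Nat.zero_sub, ← hs, Store.set_get]
    at hloop

theorem exec_forCounter_succ (hs : s.get i = m + 1) (hp : Exec p (s.set i m) t s')
    (h : Exec (forCounter i p) s' t' s'') : Exec (forCounter i p) s (t + 1 + t') s'' := by
  refine ⟨fun v => ?_⟩
  obtain ⟨v', hv'⟩ := hp.1 (some true)
  obtain ⟨v'', hv''⟩ := h.1 v'
  refine ⟨v'', .loop_true (by rw [map_head_counter_succ hs]; rfl) ?_ hv''⟩
  rwa [map_head_counter_succ hs, update_tail_counter, hs, Nat.add_sub_cancel]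

/-- The invariant `J j` describes the store after `j` rounds, except for the counter `i`. -/
theorem exec_forCounter (J : ℕ → Store)
    (hJ : ∀ j k, j + k + 1 = m → Exec p ((J j).set i k) t ((J (j + 1)).set i k)) :
    Exec (forCounter i p) ((J 0).set i m) (m * (t + 1) + 1) ((J m).set i 0) := by
  induction m generalizing J with
  | zero => exact (exec_forCounter_zero (Store.get_set ..)).mono (by omega)
  | succ m ih =>
    have hrest := ih (fun j => J (j + 1)) fun j k hjk => hJ (j + 1) k (by omega)
    have hfirst : Exec p (((J 0).set i (m + 1)).set i m) t ((J 1).set i m) := by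
      rw [Store.set_set]
      exact hJ 0 m (by omega)
    exact (exec_forCounter_succ (Store.get_set ..) hfirst hrest).mono (by rw [Nat.succ_mul]; omega)

theorem exec_transfer {i j : Counter} (hij : i ≠ j) (s : Store) :
    Exec (forCounter i (mark j)) s (2 * s.get i + 1) ((s.set j (s.get j + s.get i)).set i 0) := by
  have hloop := exec_forCounter (i := i) (p := mark j) (m := s.get i) (t := 1)
    (fun k => s.set j (s.get j + k)) fun k m _ => by
      have hmark := exec_mark j ((s.set j (s.get j + k)).set i m)
      rwa [Store.get_set_of_ne _ hij, Store.get_set, Store.set_comm _ hij, Store.set_set] at hmark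
  rw [Nat.add_zero, Store.set_get, Store.set_get] at hloop
  exact hloop.mono (by omega)

end Store

section Arithmetic

/-- One round of `divide`. -/
def divideStep : StoreProg :=
  ifCounter .states
    (.seq (mark .rem) <| ifCounter .states (mark .states) <|
      .seq (forCounter .rem (mark .states)) (mark .quot))
    .skip

/-- Divide `zeros` by the sum of `states` and `rem`. -/
def divide : StoreProg := forCounter .zeros divideStep

theorem exec_divideStep (s : Store) {n : ℕ} (hn : 0 < n) (a : ℕ) :
    Exec divideStep { s with states := n - a % n, rem := a % n, quot := a / n } (2 * n + 7)
      { s with states := n - (a + 1) % n, rem := (a + 1) % n, quot := (a + 1) / n } := by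
  have ha := Nat.div_add_mod a n
  have ha' := Nat.div_add_mod (a + 1) n
  have hlt := Nat.mod_lt a hn
  refine Exec.mono (exec_ifCounter_succ (m := n - a % n - 1) (show n - a % n = _ by omega)
    ((exec_mark _ _).seq (t' := 2 * n + 4) ?_)) (by omega)
  by_cases hdvd : n ∣ a + 1
  · rw [Nat.succ_div_of_dvd hdvd, Nat.mod_eq_zero_of_dvd hdvd, Nat.mul_succ] at *
    refine Exec.congr (exec_ifCounter_zero (show n - a % n - 1 = 0 by omega)
      ((exec_transfer (by decide) _).seq (exec_mark _ _))) ?_ ?_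
    · simp only [Store.set, Store.get, tsub_zero, Store.mk.injEq, and_self, and_true,
        true_and]
      omega
    · simp only [Store.set, Store.get]
      omega
  · rw [Nat.succ_div_of_not_dvd hdvd] at *
    have hmod : (a + 1) % n = a % n + 1 := by omega
    have := Nat.mod_lt (a + 1) hn
    rw [hmod]
    refine Exec.congr (exec_ifCounter_succ (m := n - a % n - 2)
      (show n - a % n - 1 = _ by omega) (exec_mark _ _)) ?_ (by omega)
    simp only [Store.set, Store.get, Store.mk.injEq, and_self, and_true, true_and]
    omega

theorem exec_divide (s : Store) {n : ℕ} (hn : 0 < n) (a : ℕ) :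
    Exec divide { s with states := n, rem := 0, quot := 0, zeros := a } (a * (2 * n + 8) + 1)
      { s with states := n - a % n, rem := a % n, quot := a / n, zeros := 0 } := by
  have hloop := exec_forCounter (i := .zeros) (p := divideStep) (m := a)
    (fun j => { s with states := n - j % n, rem := j % n, quot := j / n })
    fun j k _ => exec_divideStep { s with zeros := k } hn j
  simp only [Nat.zero_mod, Nat.zero_div, Nat.sub_zero] at hloop
  exact hloop

/-- Subtract `min quot square` from `quot`, which then moves to `excess`, and from `square`, and
add it to `scratch`. -/
def cancel : StoreProg := forCounter .quot (ifCounter .square (mark .scratch) (mark .excess))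

theorem exec_cancel (s : Store) (c N : ℕ) :
    Exec cancel { s with quot := c, square := N, scratch := 0, excess := 0 } (4 * c + 1)
      { s with quot := 0, square := N - c, scratch := min c N, excess := c - N } := by
  have hloop := exec_forCounter (i := .quot) (m := c) (t := 3)
    (p := ifCounter .square (mark .scratch) (mark .excess))
    (fun j => { s with square := N - j, scratch := min j N, excess := j - N }) fun j k _ => ?_
  · simp only [Nat.zero_min, Nat.zero_sub, Nat.sub_zero] at hloop
    exact hloop.mono (by omega)
  · obtain h | h := Nat.lt_or_ge j N
    · refine Exec.congr (exec_ifCounter_succ (m := N - j - 1) (show N - j = _ by omega)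
        (exec_mark _ _)) ?_ le_rfl
      simp only [Store.set, Store.get, Store.mk.injEq, true_and]
      omega
    · refine Exec.congr (exec_ifCounter_zero (show N - j = 0 by omega) (exec_mark _ _)) ?_ le_rfl
      simp only [Store.set, Store.get, Store.mk.injEq, true_and]
      omega

/-- Write `0`. -/
def emitZero : StoreProg := emit (some false)

theorem exec_emitZeros (i : Counter) (s : Store) :
    Exec (forCounter i emitZero) s (2 * s.get i + 1)
      ({ s with out := List.replicate (s.get i) (some false) ++ s.out }.set i 0) := by
  have hloop := exec_forCounter (i := i) (p := emitZero) (m := s.get i) (t := 1)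
    (fun k => { s with out := List.replicate k (some false) ++ s.out })
    fun k m _ => by cases i <;> exact exec_emit _ _
  refine (Store.set_get s i ▸ hloop).mono (by omega)

theorem exec_emitTransfer {i j : Counter} (hij : i ≠ j) (s : Store) :
    Exec (forCounter i (.seq emitZero (mark j))) s (3 * s.get i + 1)
      (({ s with out := List.replicate (s.get i) (some false) ++ s.out }.set j
        (s.get j + s.get i)).set i 0) := by
  have hloop := exec_forCounter (i := i) (p := .seq emitZero (mark j)) (m := s.get i) (t := 2)
    (fun k => { s with out := List.replicate k (some false) ++ s.out }.set j (s.get j + k))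
    fun k m _ => by
      cases i <;> cases j <;> first
        | exact absurd rfl hij
        | exact (exec_emit _ _).seq (exec_mark _ _)
  refine Exec.mono ?_ (show s.get i * 3 + 1 ≤ _ by omega)
  rwa [Nat.add_zero, List.replicate_zero, List.nil_append, Store.set_get s j, Store.set_get]
    at hloop

/-- Write `reflect square quot` zeros. -/
def emitReflect : StoreProg :=
  .seq cancel <| ifCounter .excess
    (.seq (mark .excess) <| .seq (forCounter .excess emitZero) <|
      forCounter .scratch (.seq emitZero (mark .square)))
    (.seq (forCounter .square (.seq emitZero (mark .scratch))) <|
      forCounter .scratch (mark .square))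

theorem exec_emitReflect (s : Store) (c N : ℕ) :
    Exec emitReflect { s with quot := c, square := N, scratch := 0, excess := 0 } (10 * (c + N) + 9)
      { s with
        out := List.replicate (reflect N c) (some false) ++ s.out
        quot := 0, square := N, scratch := 0, excess := 0 } := by
  obtain h | h := Nat.lt_or_ge N c
  · refine Exec.congr ((exec_cancel s c N).seq (exec_ifCounter_succ (m := c - N - 1)
      (show c - N = _ by omega) ((exec_mark _ _).seq ((exec_emitZeros _ _).seq
      (exec_emitTransfer (by decide) _))))) ?_ ?_
    · simp only [Store.set, Store.get, ← List.append_assoc, List.replicate_append_replicate,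
        reflect, h.not_ge, ↓reduceIte, Store.mk.injEq, List.append_cancel_right_eq,
        List.replicate_inj, Nat.add_eq_zero_iff, min_eq_zero, one_ne_zero, and_false, or_true,
        and_true, and_self, true_and]
      omega
    · simp only [Store.set, Store.get]
      omega
  · refine Exec.congr ((exec_cancel s c N).seq (exec_ifCounter_zero
      (show c - N = 0 by omega) ((exec_emitTransfer (by decide) _).seq
      (exec_transfer (by decide) _)))) ?_ ?_
    · simp [Store.set, Store.get, reflect, h]
    · simp only [Store.set, Store.get]
      omega

/-- Halve `value`. The quotient goes to `scratch` and the remainder to `odd`. -/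
def halve : StoreProg := forCounter .value (ifCounter .odd (mark .scratch) (mark .odd))

theorem exec_halve (s : Store) (m : ℕ) :
    Exec halve { s with value := m, scratch := 0, odd := 0 } (4 * m + 1)
      { s with value := 0, scratch := m / 2, odd := m % 2 } := by
  have hloop := exec_forCounter (i := .value) (m := m) (t := 3)
    (p := ifCounter .odd (mark .scratch) (mark .odd))
    (fun j => { s with scratch := j / 2, odd := j % 2 }) fun j k _ => ?_
  · exact hloop.mono (by omega)
  · obtain h | h := Nat.mod_two_eq_zero_or_one j
    · refine Exec.congr (exec_ifCounter_zero (show j % 2 = 0 from h) (exec_mark _ _)) ?_ le_rfl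
      simp only [Store.set, Store.get, Store.mk.injEq, and_true, true_and]
      omega
    · refine Exec.congr (exec_ifCounter_succ (m := 0) (show j % 2 = _ from h) (exec_mark _ _)) ?_
        le_rfl
      simp only [Store.set, Store.get, Store.mk.injEq, and_true, true_and]
      omega

/-- Write the parity `odd`. -/
def emitOdd : StoreProg := ifCounter .odd (emit (some true)) emitZero

theorem exec_emitOdd (s : Store) (b : Bool) :
    Exec emitOdd { s with odd := b.toNat } 3 { s with out := some b :: s.out, odd := 0 } := by
  cases b
  · exact exec_ifCounter_zero rfl (exec_emit _ _)
  · exact exec_ifCounter_succ (m := 0) rfl (exec_emit _ _)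

/-- Write the last binary digit of `value` and remove it. -/
def emitDigit : StoreProg := .seq halve <| .seq emitOdd <| forCounter .scratch (mark .value)

theorem exec_emitDigit (s : Store) (b : Bool) (m : ℕ) :
    Exec emitDigit { s with value := Nat.bit b m, scratch := 0, odd := 0 } (10 * m + 9)
      { s with out := some b :: s.out, value := m, scratch := 0, odd := 0 } := by
  have hhalve := exec_halve s (Nat.bit b m)
  rw [← Nat.div2_val, Nat.div2_bit, Nat.mod_two_of_bodd, Nat.bodd_bit] at hhalve
  refine Exec.congr (hhalve.seq ((exec_emitOdd { s with value := 0, scratch := m } b).seq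
    (exec_transfer (by decide) _))) ?_ ?_
  · simp [Store.set, Store.get]
  · have := Bool.toNat_le b
    simp only [Store.get, Nat.bit_val]
    omega

/-- Write `value` in binary. -/
def emitBinary : StoreProg := forCounter .value <| .seq (mark .value) emitDigit

theorem exec_emitBinary (s : Store) (m : ℕ) :
    Exec emitBinary { s with value := m, scratch := 0, odd := 0 } (25 * m + 1)
      { s with
        out := (Nat.bits m).reverse.map some ++ s.out
        value := 0, scratch := 0, odd := 0 } := by
  induction m using Nat.binaryRec' generalizing s with
  | zero => exact exec_forCounter_zero rfl
  | bit b m hb ih =>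
    have hpos : 0 < Nat.bit b m := Nat.pos_of_ne_zero (by simpa [Nat.bit_eq_zero_iff] using hb)
    obtain ⟨k, hk⟩ := Nat.exists_eq_add_one.2 hpos
    have hround : Exec (.seq (mark .value) emitDigit) { s with value := k, scratch := 0, odd := 0 }
        (1 + (10 * m + 9)) { s with out := some b :: s.out, value := m, scratch := 0, odd := 0 } :=
      (exec_mark _ _).seq (hk ▸ exec_emitDigit s b m)
    refine Exec.congr (exec_forCounter_succ hk hround
      (ih { s with out := some b :: s.out })) ?_ ?_
    · simp [Nat.bits_append_bit m b hb]
    · rw [Nat.bit_val] at *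
      omega

end Arithmetic

section Buffer

/-- Read symbols from the buffer and run `p` as long as they satisfy `c`. -/
def readWhile (c : Option Bool → Bool) (p : StoreProg) : StoreProg :=
  .loop .buf (fun _ o => o.join) c p

variable {c : Option Bool → Bool} {p : StoreProg} {v v' v'' x : Option Bool}
  {l : List (Option Bool)} {s s' s'' : Store} {t t' : ℕ}

theorem run_readWhile_false (hs : s.buf = x :: l) (hx : c x = false) :
    (readWhile c p).Run v s.toStacks 1 x { s with buf := l }.toStacks := by
  have hloop := Prog.Run.loop_false (k := .buf) (f := fun _ o => o.join) (c := c) (p := p) (v := v)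
    (S := s.toStacks) (by rw [Store.toStacks, hs]; exact hx)
  rwa [Store.update_buf, Store.toStacks, hs] at hloop

theorem run_readWhile_true (hs : s.buf = x :: l) (hx : c x = true)
    (hp : p.Run x { s with buf := l }.toStacks t v' s'.toStacks)
    (h : (readWhile c p).Run v' s'.toStacks t' v'' s''.toStacks) :
    (readWhile c p).Run v s.toStacks (t + 1 + t') v'' s''.toStacks := by
  refine .loop_true (by rw [Store.toStacks, hs]; exact hx) ?_ h
  rwa [Store.update_buf, Store.toStacks, hs]

/-- Read zeros from the buffer and count them. -/
def readZeros : StoreProg := readWhile (· = some false) (mark .zeros)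

theorem run_readZeros (s : Store) (a : ℕ) (hx : x ≠ some false) :
    readZeros.Run v { s with buf := List.replicate a (some false) ++ x :: l }.toStacks (2 * a + 1) x
      { s with buf := l, zeros := s.zeros + a }.toStacks := by
  induction a generalizing v s with
  | zero => exact run_readWhile_false rfl (decide_eq_false hx)
  | succ a ih =>
    obtain ⟨v', hmark⟩ := (exec_mark .zeros
      { s with buf := List.replicate a (some false) ++ x :: l }).1 (some false)
    have hloop := run_readWhile_true (v := v)
      (s := { s with buf := List.replicate (a + 1) (some false) ++ x :: l }) rfl rfl hmark
      (ih (v := v') { s with zeros := s.zeros + 1 })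
    rw [Nat.add_right_comm s.zeros] at hloop
    exact hloop.mono (show _ ≤ 2 * (a + 1) + 1 by omega)

/-- Move letters from the buffer to the output. -/
def copyLetters : StoreProg := readWhile Option.isSome (.push .out id)

theorem exec_copyLetters {w : List Bool} (hs : s.buf = w.map some ++ none :: l) :
    Exec copyLetters s (2 * w.length + 1)
      { s with buf := l, out := w.reverse.map some ++ s.out } := by
  refine ⟨fun v => ⟨none, ?_⟩⟩
  induction w generalizing v s with
  | nil => exact run_readWhile_false hs rfl
  | cons b w ih =>
    have hpush := Prog.Run.push (Γ := Stack.Sym) (k := .out) (v := some b)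
      (S := { s with buf := w.map some ++ none :: l }.toStacks) id
    rw [Store.update_out] at hpush
    have hloop := run_readWhile_true (v := v) hs rfl hpush (ih rfl (some b))
    simp only [List.reverse_cons, List.map_append, List.append_assoc]
    exact hloop.mono (by rw [List.length_cons]; omega)

/-- Write the zeros of an output of the form `0ᵇ` whose code has `zeros` zeros. -/
def writeZeros : StoreProg := .seq divide (forCounter .quot emitZero)

theorem exec_writeZeros {n : ℕ} (hn : 0 < n) (q a : ℕ) (l out : List (Option Bool)) :
    Exec writeZeros
      { buf := l, out := out, states := n, source := q, zeros := a, square := n ^ 2 }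
      (a * (2 * n + 10) + 2)
      { buf := l, out := (List.replicate (a / n) false).map some ++ out, states := n - a % n
        source := q, rem := a % n, square := n ^ 2 } := by
  rw [List.map_replicate]
  refine Exec.mono ((exec_divide { buf := l, out := out, source := q, square := n ^ 2 } hn a).seq
    (exec_emitZeros _ _)) ?_
  have := Nat.div_le_self a n
  simp only [Store.get, Nat.mul_add]
  omega

/-- Write an output of the form `z10ᵇ` whose code ends in `zeros` zeros and whose letters `z` are in
the buffer. -/
def writeLetters : StoreProg :=
  .seq divide <| .seq emitReflect <| .seq (emit (some true)) copyLetters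

theorem exec_writeLetters {n : ℕ} (hn : 0 < n) (q a : ℕ) (z : List Bool)
    (l out : List (Option Bool)) :
    Exec writeLetters
      { buf := (z.map some).reverse ++ none :: l, out := out, states := n, source := q, zeros := a
        square := n ^ 2 }
      (a * (2 * n + 18) + 10 * n ^ 2 + 2 * z.length + 12)
      { buf := l
        out := (z ++ true :: List.replicate (reflect (n ^ 2) (a / n)) false).map some ++ out
        states := n - a % n, source := q, rem := a % n, square := n ^ 2 } := by
  rw [← List.map_reverse]
  refine Exec.congr ((exec_divide { buf := z.reverse.map some ++ none :: l, out := out, source := q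
                                    square := n ^ 2 } hn a).seq
    ((exec_emitReflect { buf := z.reverse.map some ++ none :: l, out := out, states := n - a % n
                         source := q, rem := a % n } (a / n) (n ^ 2)).seq
    ((exec_emit _ _).seq (exec_copyLetters rfl)))) ?_ ?_
  · simp
  · have := Nat.div_le_self a n
    rw [List.length_reverse]
    simp only [Nat.mul_add]
    omega

/-- Read the code of a transition, write its output, and put its target into `rem`. -/
def readCode : StoreProg := .seq readZeros <| .ite Option.isSome writeLetters writeZeros

theorem exec_readCode {n L : ℕ} [NeZero n] (q : ℕ) (u : List Bool) (l out : List (Option Bool))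
    (hn : n ≤ L) (hu : u.length < L) :
    Exec readCode
      { buf := (u.map some).reverse ++ none :: l, out := out, states := n, source := q
        square := n ^ 2 }
      (60 * L ^ 2)
      { buf := l, out := ((pairEquiv n).symm u).2.map some ++ out
        states := n - ((pairEquiv n).symm u).1, source := q, rem := ((pairEquiv n).symm u).1
        square := n ^ 2 } := by
  obtain ⟨z, a, rfl⟩ : ∃ z a, u = joinZeros z a := ⟨_, _, (joinZeros_splitZeros u).symm⟩
  rw [pairEquiv_symm_joinZeros]
  have hpos := NeZero.pos n
  refine ⟨fun v => ?_⟩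
  cases z with
  | none =>
    have hbuf : ((joinZeros none a).map some).reverse ++ none :: l =
        List.replicate a (some false) ++ none :: l := by simp [joinZeros]
    have ha : a < L := by simpa [joinZeros] using hu
    have hzeros := run_readZeros (v := v) (x := none) (l := l)
      { out := out, states := n, source := q, square := n ^ 2 } a (by simp)
    obtain ⟨v', hwrite⟩ := (exec_writeZeros hpos q a l out).1 none
    rw [Nat.zero_add] at hzeros
    rw [hbuf]
    exact ⟨v', (hzeros.seq (.ite_false rfl hwrite)).mono (by nlinarith)⟩
  | some z =>
    have hbuf : ((joinZeros (some z) a).map some).reverse ++ none :: l =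
        List.replicate a (some false) ++ some true :: ((z.map some).reverse ++ none :: l) := by
      simp [joinZeros]
    have hlength : z.length + a + 1 < L := by simpa [joinZeros, Nat.add_assoc] using hu
    have hzeros := run_readZeros (v := v) (x := some true) (l := (z.map some).reverse ++ none :: l)
      { out := out, states := n, source := q, square := n ^ 2 } a (by simp)
    obtain ⟨v', hwrite⟩ := (exec_writeLetters hpos q a z l out).1 (some true)
    rw [Nat.zero_add] at hzeros
    rw [hbuf]
    exact ⟨v', (hzeros.seq (.ite_true rfl hwrite)).mono (by nlinarith)⟩

end Buffer

section Decoder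

/-- Write the name of the state `rem`, and move `rem` to `states`. -/
def writeTarget : StoreProg :=
  .seq (forCounter .rem (.seq (mark .value) (mark .states))) <| .seq (mark .value) emitBinary

theorem exec_writeTarget (s : Store) (r m : ℕ) :
    Exec writeTarget { s with states := r, rem := m, value := 0, scratch := 0, odd := 0 }
      (28 * m + 28)
      { s with
        out := (Nat.bits (m + 1)).reverse.map some ++ s.out
        states := r + m, rem := 0, value := 0, scratch := 0, odd := 0 } := by
  have hmove := exec_forCounter (i := .rem) (p := .seq (mark .value) (mark .states)) (m := m)
    (fun k => { s with states := r + k, value := k, scratch := 0, odd := 0 })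
    fun k m _ => (exec_mark _ _).seq (exec_mark _ _)
  exact (hmove.seq ((exec_mark _ _).seq
    (exec_emitBinary { s with states := r + m, rem := 0 } (m + 1)))).mono (by omega)

/-- Add the counter `source` to the counter `i`. -/
def addSource (i : Counter) : StoreProg :=
  .seq (forCounter .source (.seq (mark i) (mark .rem))) (forCounter .rem (mark .source))

theorem exec_addSource {i : Counter} (hsource : i ≠ .source) (hrem : i ≠ .rem) (s : Store) (m : ℕ) :
    Exec (addSource i) { s with source := m, rem := 0 } (5 * m + 2)
      { s.set i (s.get i + m) with source := m, rem := 0 } := by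
  have hadd := exec_forCounter (i := .source) (p := .seq (mark i) (mark .rem)) (m := m) (t := 2)
    (fun j => { s.set i (s.get i + j) with rem := j }) fun j k _ => by
      cases i <;> first | exact absurd rfl hsource | exact absurd rfl hrem |
        exact (exec_mark _ _).seq (exec_mark _ _)
  have hrestore := exec_forCounter (i := .rem) (p := mark .source) (m := m)
    (fun j => { s.set i (s.get i + m) with source := j }) fun j k _ => exec_mark _ _
  rw [Nat.add_zero, Store.set_get] at hadd
  exact (hadd.seq hrestore).mono (by omega)

/-- Write the name of the state `source`. -/
def writeSource : StoreProg := .seq (addSource .value) <| .seq (mark .value) emitBinary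

theorem exec_writeSource (s : Store) (m : ℕ) :
    Exec writeSource { s with source := m, rem := 0, value := 0, scratch := 0, odd := 0 }
      (30 * m + 29)
      { s with
        out := (Nat.bits (m + 1)).reverse.map some ++ s.out
        source := m, rem := 0, value := 0, scratch := 0, odd := 0 } := by
  have hadd := exec_addSource (i := .value) (by decide) (by decide)
    { s with value := 0, scratch := 0, odd := 0 } m
  rw [Store.get, Nat.zero_add] at hadd
  exact (hadd.seq ((exec_mark _ _).seq
    (exec_emitBinary { s with source := m, rem := 0 } (m + 1)))).mono (by omega)

/-- Read the code of a transition with source `source` and input letter `i`, and write it. -/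
def writeTransition (i : Bool) : StoreProg :=
  .seq (emit none) <| .seq readCode <| .seq (emit none) <| .seq writeTarget <|
    .seq (emit none) <| .seq (emit (some i)) <| .seq (emit none) writeSource

variable (T : Transducer) {L : ℕ}

theorem exec_writeTransition (q : Fin T.numStates) (i : Bool) (l out : List (Option Bool))
    (hn : T.numStates ≤ L) (hu : (T.pairCode q i).length < L) :
    Exec (writeTransition i)
      { buf := ((T.pairCode q i).map some).reverse ++ none :: l, out := out
        states := T.numStates, source := q, square := T.numStates ^ 2 }
      (180 * L ^ 2)
      { buf := l, out := T.transition q i ++ out, states := T.numStates, source := q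
        square := T.numStates ^ 2 } := by
  have hread := exec_readCode q (T.pairCode q i) l (none :: out) hn hu
  rw [Transducer.pairCode, Equiv.symm_apply_apply, ← Transducer.pairCode] at hread
  have hwrite := exec_writeTarget
    { buf := l, out := none :: ((T.Δ q i).2.map some ++ none :: out), source := q
      square := T.numStates ^ 2 } (T.numStates - (T.Δ q i).1) (T.Δ q i).1
  rw [Nat.sub_add_cancel (T.Δ q i).1.isLt.le] at hwrite
  refine Exec.congr ((exec_emit _ _).seq (hread.seq ((exec_emit _ _).seq (hwrite.seq
    ((exec_emit _ _).seq ((exec_emit _ _).seq ((exec_emit _ _).seq (exec_writeSource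
      { buf := l, out := none :: some i :: none :: _, states := T.numStates
        square := T.numStates ^ 2 } q)))))))) ?_ ?_
  · simp [Transducer.transition, Transducer.stateName]
  · have hp := (T.Δ q i).1.isLt
    have hq := q.isLt
    nlinarith

/-- Write the two transitions from the state `source`. -/
def writeRow : StoreProg := .seq (writeTransition true) (writeTransition false)

theorem exec_writeRow (q : Fin T.numStates) (l out : List (Option Bool))
    (hn : T.numStates ≤ L) (hL : ∀ i, (T.pairCode q i).length < L) :
    Exec writeRow
      { buf := (rowSymbols (T.pairCode q false, T.pairCode q true)).reverse ++ l, out := out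
        states := T.numStates, source := q, square := T.numStates ^ 2 }
      (360 * L ^ 2)
      { buf := l, out := T.transition q false ++ T.transition q true ++ out
        states := T.numStates, source := q, square := T.numStates ^ 2 } := by
  have htrue := exec_writeTransition T q true
    (((T.pairCode q false).map some).reverse ++ none :: l) out hn (hL _)
  have hfalse := exec_writeTransition T q false l (T.transition q true ++ out) hn (hL _)
  rw [List.append_assoc]
  refine Exec.mono ?_ (show 180 * L ^ 2 + 180 * L ^ 2 ≤ _ by omega)
  have hrow : (rowSymbols (T.pairCode q false, T.pairCode q true)).reverse ++ l =
      ((T.pairCode q true).map some).reverse ++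
        none :: (((T.pairCode q false).map some).reverse ++ none :: l) := by
    simp [rowSymbols]
  rw [hrow]
  exact htrue.seq hfalse

/-- Write the transitions whose codes are in the buffer. -/
def writeTransitions : StoreProg := forCounter .source writeRow

theorem exec_writeTransitions (hn : T.numStates ≤ L)
    (hL : ∀ q i, (T.pairCode q i).length < L) :
    Exec writeTransitions
      { buf := T.symbols.reverse, states := T.numStates, source := T.numStates
        square := T.numStates ^ 2 }
      (T.numStates * (360 * L ^ 2 + 1) + 1)
      { out := T.transitionList, states := T.numStates, square := T.numStates ^ 2 } := by
  have hloop := exec_forCounter (i := .source) (p := writeRow) (m := T.numStates)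
    (t := 360 * L ^ 2)
    (fun j => { buf := ((T.rows.take (T.numStates - j)).flatMap rowSymbols).reverse
                out := ((List.finRange T.numStates).drop (T.numStates - j)).flatMap fun q =>
                  T.transition q false ++ T.transition q true
                states := T.numStates, square := T.numStates ^ 2 }) fun j k hjk => by
      have hk : k < T.numStates := by omega
      have hrows : T.rows.take (k + 1) = T.rows.take k ++
          [(T.pairCode ⟨k, hk⟩ false, T.pairCode ⟨k, hk⟩ true)] := by
        rw [List.take_succ_eq_append_getElem (by simpa [Transducer.rows] using hk)]
        simp [Transducer.rows]
      have hstates : (List.finRange T.numStates).drop k =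
          ⟨k, hk⟩ :: (List.finRange T.numStates).drop (k + 1) := by
        rw [List.drop_eq_getElem_cons (by simpa using hk), List.getElem_finRange]
        rfl
      rw [show T.numStates - j = k + 1 by omega, show T.numStates - (j + 1) = k by omega, hrows,
        hstates, List.flatMap_append, List.flatMap_singleton, List.reverse_append,
        List.flatMap_cons]
      exact exec_writeRow T ⟨k, hk⟩ _ _ hn (hL _)
  have hrows : T.rows.take T.numStates = T.rows :=
    List.take_of_length_le (by simp [Transducer.rows])
  have hstates : (List.finRange T.numStates).drop T.numStates = [] :=
    List.drop_of_length_le (by simp)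
  simpa [Store.set, Transducer.transitionList, Transducer.symbols, writeTransitions, hrows,
    hstates] using hloop

/-- Put a separator into the buffer, and count it. -/
def readSeparator : StoreProg := .seq (.push .buf fun _ => none) (mark .value)

theorem exec_readSeparator (s : Store) :
    Exec readSeparator s 2 { s with buf := none :: s.buf, value := s.value + 1 } := by
  refine ⟨fun v => ?_⟩
  have hpush := Prog.Run.push (Γ := Stack.Sym) (k := .buf) (v := v) (S := s.toStacks) fun _ => none
  rw [Store.update_buf] at hpush
  obtain ⟨v', hmark⟩ := (exec_mark .value { s with buf := none :: s.buf }).1 v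
  exact ⟨v', hpush.seq hmark⟩

/-- Decode a symbol whose first bit is in the register. -/
def readSymbol : StoreProg :=
  .ite (· = some true) (.seq (.pop .inp fun _ o => o) (.push .buf id)) readSeparator

theorem run_readSymbol_some {b : Bool} {w : List Bool} {s : Store} (hs : s.inp = b :: w) :
    readSymbol.Run (some true) s.toStacks 3 (some b)
      { s with inp := w, buf := some b :: s.buf }.toStacks := by
  have hpop := Prog.Run.pop (k := .inp) (f := fun _ o => o) (v := some true) (S := s.toStacks)
  rw [Store.update_inp, Store.toStacks, hs] at hpop
  have hpush := Prog.Run.push (Γ := Stack.Sym) (k := .buf) (v := some b)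
    (S := { s with inp := w }.toStacks) id
  rw [Store.update_buf] at hpush
  exact .ite_true rfl (hpop.seq hpush)

/-- Decode the input into the buffer, and count the separators. -/
def readInput : StoreProg := .loop .inp (fun _ o => o) Option.isSome readSymbol

theorem run_readInput_cons {b : Bool} {w : List Bool} {s s' s'' : Store} {v v' v'' : Option Bool}
    {t t' : ℕ} (hs : s.inp = b :: w)
    (hp : readSymbol.Run (some b) { s with inp := w }.toStacks t v' s'.toStacks)
    (h : readInput.Run v' s'.toStacks t' v'' s''.toStacks) :
    readInput.Run v s.toStacks (t + 1 + t') v'' s''.toStacks := by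
  refine .loop_true (by rw [Store.toStacks, hs]; rfl) ?_ h
  rwa [Store.update_inp, Store.toStacks, hs]

theorem exec_readInput (l l' : List (Option Bool)) (m : ℕ) :
    Exec readInput { inp := bits l, buf := l', value := m } (4 * l.length + 1)
      { buf := l.reverse ++ l', value := m + l.count none } := by
  induction l generalizing l' m with
  | nil =>
    refine ⟨fun v => ⟨none, ?_⟩⟩
    have hloop := Prog.Run.loop_false (k := .inp) (f := fun _ o => o) (c := Option.isSome)
      (p := readSymbol) (v := v) (S := { buf := l', value := m : Store }.toStacks) rfl
    rwa [Store.update_inp] at hloop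
  | cons x l ih =>
    refine ⟨fun v => ?_⟩
    rw [List.length_cons, List.reverse_cons, List.append_assoc, List.singleton_append]
    cases x with
    | none =>
      obtain ⟨v', hread⟩ :=
        (exec_readSeparator { inp := bits l, buf := l', value := m }).1 (some false)
      obtain ⟨v'', hloop⟩ := (ih (none :: l') (m + 1)).1 v'
      rw [List.count_cons_self, ← Nat.add_assoc m, Nat.add_right_comm m]
      exact ⟨v'', (run_readInput_cons rfl (.ite_false rfl hread) hloop).mono (by omega)⟩
    | some b =>
      obtain ⟨v', hloop⟩ := (ih (some b :: l') m).1 (some b)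
      rw [List.count_cons_of_ne (by simp)]
      exact ⟨v', (run_readInput_cons rfl (run_readSymbol_some rfl) hloop).mono (by omega)⟩

/-- Decode the input into the buffer, and count the states. -/
def setup : StoreProg :=
  .seq readSeparator <| .seq readInput <| .seq halve <|
    .seq (forCounter .scratch (.seq (mark .states) (.seq (mark .source) (mark .zeros))))
      (forCounter .zeros (addSource .square))

theorem exec_setup :
    Exec setup { inp := T.code }
      (4 * T.symbols.length + T.numStates * (5 * T.numStates + 15) + 8)
      { buf := T.symbols.reverse, states := T.numStates, source := T.numStates
        square := T.numStates ^ 2 } := by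
  have hread := exec_readInput T.symbols.tail [none] 1
  have hbuf : T.symbols.tail.reverse ++ [none] = T.symbols.reverse := by
    rw [← List.reverse_cons, T.none_cons_tail_symbols]
  have hcount : 1 + T.symbols.tail.count none = 2 * T.numStates := by
    rw [← T.count_none_symbols, ← T.none_cons_tail_symbols, List.count_cons_self, List.tail_cons,
      Nat.add_comm]
  rw [← Transducer.code, hbuf, hcount] at hread
  have hhalve := exec_halve { buf := T.symbols.reverse } (2 * T.numStates)
  rw [Nat.mul_div_cancel_left _ two_pos, Nat.mul_mod_right] at hhalve
  have hcopy := exec_forCounter (i := .scratch) (m := T.numStates)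
    (p := .seq (mark .states) (.seq (mark .source) (mark .zeros)))
    (fun k => { buf := T.symbols.reverse, states := k, source := k, zeros := k })
    fun k m _ => (exec_mark _ _).seq ((exec_mark _ _).seq (exec_mark _ _))
  have hsquare := exec_forCounter (i := .zeros) (p := addSource .square) (m := T.numStates)
    (fun k => { buf := T.symbols.reverse, states := T.numStates, source := T.numStates
                square := k * T.numStates }) fun k m _ => by
      rw [Nat.succ_mul]
      exact exec_addSource (by decide) (by decide)
        { buf := T.symbols.reverse, states := T.numStates, zeros := m
          square := k * T.numStates } T.numStates
  rw [Nat.zero_mul, ← sq] at hsquare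
  refine Exec.mono ((exec_readSeparator _).seq (hread.seq (hhalve.seq (hcopy.seq hsquare)))) ?_
  simp only [List.length_tail, Nat.mul_add]
  omega

/-- The program that computes the transitions of a transducer from its code. -/
def decoder : StoreProg :=
  .seq setup <| .seq writeTransitions <| .seq (forCounter .states .skip) (forCounter .square .skip)

theorem exec_decoder :
    Exec decoder { inp := T.code } (500 * (T.code.length + 1) ^ 3) { out := T.transitionList } := by
  have hlength := T.length_code_add_one
  have hpos := NeZero.pos T.numStates
  have hwrite := exec_writeTransitions T (L := T.code.length + 1) (by omega) fun q i => by
    have := T.length_pairCode_le_weight q i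
    omega
  have hstates := exec_forCounter (i := .states) (p := .skip) (m := T.numStates)
    (fun _ => { out := T.transitionList, square := T.numStates ^ 2 }) fun _ _ _ => exec_skip _
  have hsquare := exec_forCounter (i := .square) (p := .skip) (m := T.numStates ^ 2)
    (fun _ => { out := T.transitionList }) fun _ _ _ => exec_skip _
  refine Exec.mono ((exec_setup T).seq (hwrite.seq (hstates.seq hsquare))) ?_
  generalize hL : T.code.length + 1 = L at *
  have hlinear : L ≤ L ^ 3 := Nat.le_self_pow three_ne_zero L
  have hquadratic : L ^ 2 ≤ L ^ 3 := Nat.pow_le_pow_right (by omega) (by norm_num)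
  rw [T.length_symbols]
  calc
    _ ≤ 4 * (2 * L + L) + L * (5 * L + 15) + 8 +
        (L * (360 * L ^ 2 + 1) + 1 + (L * (1 + 1) + 1 + (L ^ 2 * (1 + 1) + 1))) := by
      gcongr <;> omega
    _ ≤ _ := by nlinarith

theorem onlyStack_inp (l : List Bool) :
    Prog.onlyStack (Γ := Stack.Sym) .inp l = Store.toStacks { inp := l } := by
  funext k
  cases k with
  | counter i => cases i <;> rfl
  | _ => rfl

theorem onlyStack_out (l : List (Option Bool)) :
    Prog.onlyStack (Γ := Stack.Sym) .out l = Store.toStacks { out := l } := by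
  funext k
  cases k with
  | counter i => cases i <;> rfl
  | _ => rfl

theorem polyTime_decode : Nonempty (TM2ComputableInPolyTime
    (fun c : runEncoding.dom => (c : List Bool)) Transducer.transitionList runEncoding.decode) := by
  let _ : Fintype (Stack.Sym .inp) := inferInstanceAs (Fintype Bool)
  refine ⟨Prog.polyTime (k₀ := .inp) (k₁ := .out) decoder none _ _ _
    (500 * (Polynomial.X + 1) ^ 3) fun c => ?_⟩
  have hdecoder := (exec_decoder (runEncoding.decode c)).1 none
  rw [code_decode_runEncoding] at hdecoder
  simpa [onlyStack_inp, onlyStack_out] using hdecoder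

end Decoder

end FSC

theorem corollary2 :
    ∃ S : FSC.Encoding, S.IsPolyTime ∧ ∀ n : ℕ, 1 ≤ n → S.level (n - 1) ⊂ S.level n :=
  ⟨FSC.runEncoding,
    ⟨FSC.polyTime_of_isRegular FSC.isRegular_range_code, FSC.polyTime_decode⟩,
    fun _ hn => FSC.level_runEncoding_ssubset hn⟩
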